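/- **Setting.** Consider structural causal models over finitely many variables: a binary treatment $T\in\{0,1\}$, an outcome $Y$ with values in a set $\mathcal Y\subseteq\mathbb R$, observed covariates $X=(X_i)_i$, and possibly unobserved variables, the $X_i$ and the unobserved variables having values in arbitrary measurable spaces. A model consists of an acyclic directed graph and, for each variable, a measurable structural equation computing it from its parents and a noise variable; the noise variables are independent. Write $f_Y(a,U_Y)$ for the structural equation of $Y$ with its parents set to $a$, and $\mathbb E[Y\mid \mathrm{Pa}(Y)=a]=\mathbb E[f_Y(a,U_Y)]$ and $V(Y\mid\mathrm{Pa}(Y)=a)=\mathrm{Var}(f_Y(a,U_Y))$; these are defined for every value $a$ of the parents. Fix a model $M$ in which every parent of $Y$ is the treatment or an observed covariate, and let $\mathrm{Pa}(Y)$ denote the parents of $Y$ in $M$. An intervention, atomic or stochastic, replaces the structural equations and noises of any set of variables; intervened variables may lose parents but gain none. An environment $e$, with variables $(T^e,X^e,Y^e)$, is *valid* if it is created from $M$ by an intervention such that, for every value $a$, (i) $\mathbb E[Y^e\mid\mathrm{Pa}(Y)=a]=\mathbb E[Y\mid \mathrm{Pa}(Y)=a]$ (both existing), and (ii) $V(Y^e\mid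 \mathrm{Pa}(Y)=a)<\infty$. Let $L:\mathbb R\times\mathcal Y\to[0,\infty]$ be a measurable loss (prediction first, outcome second), $H$ a measurable space and $\Phi:(t,x)\mapsto\Phi(t,x)\in H$ a measurable representation. Assume that risk minimizers of $L$ are conditional expectations: for every joint law of $(h,y)$ on $H\times\mathcal Y$ with $\mathbb E[y^2]<\infty$, every measurable $w:H\to\mathbb R$ that minimizes $\mathbb E[L(w(h),y)]$ over all measurable functions $H\to\mathbb R$ satisfies $w(h)=\mathbb E[y\mid h]$ almost surely. Assume that $\Phi$ elicits a predictor that is invariant across all valid environments: there is a measurable $w:H\to\mathbb R$ that, simultaneously for all valid environments $e$, minimizes the risk $\bar w\mapsto\mathbb E[L(\bar w(\Phi(T^e,X^e)),Y^e)]$ over all measurable $\bar w:H\to\mathbb R$. Put $Q^{\mathrm{inv}}=w\circ\Phi$. **Theorem.** Let $e$ be a valid environment such that $X^e$ contains no mediators between treatment and outcome, i.e. no $X^e_i$ lies on a directed path from $T^e$ to $Y^e$ in the graph of $e$. Suppose that the average treatment effect on the treated, $$\psi^e=\mathbb E[Y^e\mid \mathrm{do}(T^e=1),\,T^e=1]-\mathbb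 E[Y^e\mid\mathrm{do}(T^e=0),\,T^e=1],$$ is defined, i.e. $P(T^e=1)>0$ and the outcomes under $\mathrm{do}(T^e=1)$ and $\mathrm{do}(T^e=0)$ are integrable conditionally on $T^e=1$. Then $Q^{\mathrm{inv}}(1,X^e)-Q^{\mathrm{inv}}(0,X^e)$ is integrable conditionally on $T^e=1$, and $$\psi^e=\mathbb E\big[Q^{\mathrm{inv}}(1,X^e)-Q^{\mathrm{inv}}(0,X^e)\,\big|\,T^e=1\big].$$ -/

import Mathlib

open MeasureTheory ProbabilityTheory
open scoped ENNReal

/-- The variables of a causal model: a treatment `T`, an outcome `Y`, observed covariates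
`X = (X i)`, and possibly further unobserved variables. -/
inductive Node (ι κ : Type*) where
  | treatment : Node ι κ
  | outcome : Node ι κ
  | covariate (i : ι) : Node ι κ
  | latent (j : κ) : Node ι κ

open Classical in
noncomputable instance Node.instFintype {ι κ : Type*} [Fintype ι] [Fintype κ] :
    Fintype (Node ι κ) :=
  Fintype.ofSurjective
    (fun s : (Bool ⊕ ι) ⊕ κ => match s with
      | .inl (.inl true) => Node.treatment
      | .inl (.inl false) => Node.outcome
      | .inl (.inr i) => Node.covariate i
      | .inr j => Node.latent j)
    (fun v => match v with
      | .treatment => ⟨.inl (.inl true), rfl⟩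
      | .outcome => ⟨.inl (.inl false), rfl⟩
      | .covariate i => ⟨.inl (.inr i), rfl⟩
      | .latent j => ⟨.inr j, rfl⟩)

/-- The value space of each variable. The treatment is binary (`true` is `1`, `false` is `0`), the
outcome takes values in a set `𝒴` of real numbers, the other variables in arbitrary measurable
spaces. -/
def Val {ι κ : Type*} (𝒴 : Set ℝ) (𝒳 : ι → Type) (𝒰 : κ → Type) : Node ι κ → Type
  | .treatment => Bool
  | .outcome => 𝒴
  | .covariate i => 𝒳 i
  | .latent j => 𝒰 j

instance Val.instMeasurableSpace {ι κ : Type*} (𝒴 : Set ℝ) (𝒳 : ι → Type) (𝒰 : κ → Type)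
    [∀ i, MeasurableSpace (𝒳 i)] [∀ j, MeasurableSpace (𝒰 j)] (v : Node ι κ) :
    MeasurableSpace (Val 𝒴 𝒳 𝒰 v) :=
  match v with
  | .treatment => inferInstanceAs (MeasurableSpace Bool)
  | .outcome => inferInstanceAs (MeasurableSpace 𝒴)
  | .covariate i => inferInstanceAs (MeasurableSpace (𝒳 i))
  | .latent j => inferInstanceAs (MeasurableSpace (𝒰 j))

/-- A structural causal model: an acyclic causal graph (`edge p v` means that `p` is a parent of
`v`) and, for each variable `v`, a structural equation computing `v` from its parents and a noise
variable. The noise variables are jointly independent (see `SCM.noise`). -/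
structure SCM {ι κ : Type*} (𝒴 : Set ℝ) (𝒳 : ι → Type) (𝒰 : κ → Type)
    [∀ i, MeasurableSpace (𝒳 i)] [∀ j, MeasurableSpace (𝒰 j)] where
  edge : Node ι κ → Node ι κ → Prop
  acyclic : ∀ v, ¬ Relation.TransGen edge v v
  Noise : Node ι κ → Type
  instNoise : ∀ v, MeasurableSpace (Noise v)
  noiseLaw : ∀ v, Measure (Noise v)
  isProb : ∀ v, IsProbabilityMeasure (noiseLaw v)
  mech : ∀ v, (∀ p : {p // edge p v}, Val 𝒴 𝒳 𝒰 p.1) → Noise v → Val 𝒴 𝒳 𝒰 v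
  measurable_mech : ∀ v, Measurable (Function.uncurry (mech v))

attribute [instance] SCM.instNoise SCM.isProb

namespace SCM

section Basic

variable {ι κ : Type*} {𝒴 : Set ℝ} {𝒳 : ι → Type} {𝒰 : κ → Type}
  [∀ i, MeasurableSpace (𝒳 i)] [∀ j, MeasurableSpace (𝒰 j)]

/-- Atomic intervention `do(v = x)` for every `v` with `c v = some x`: the edges into `v` are
removed and the structural equation of `v` is replaced by the constant `x`. Variables with
`c v = none` keep their structural equation; all noise variables are kept. -/
def atomicDo (M : SCM 𝒴 𝒳 𝒰) (c : ∀ v, Option (Val 𝒴 𝒳 𝒰 v)) : SCM 𝒴 𝒳 𝒰 where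
  edge p v := c v = none ∧ M.edge p v
  acyclic v h := M.acyclic v (Relation.TransGen.mono (fun _ _ h => h.2) v v h)
  Noise := M.Noise
  instNoise := M.instNoise
  noiseLaw := M.noiseLaw
  isProb := M.isProb
  mech v a u :=
    match h : c v with
    | some x => x
    | none => M.mech v (fun p => a ⟨p.1, h, p.2⟩) u
  measurable_mech v := by
    by_cases h : c v = none
    · have h1 : Measurable (fun q : (∀ p : {p // c v = none ∧ M.edge p v}, Val 𝒴 𝒳 𝒰 p.1) ×
          M.Noise v => Function.uncurry (M.mech v) (fun p => q.1 ⟨p.1, h, p.2⟩, q.2)) := by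
        refine (M.measurable_mech v).comp (Measurable.prodMk ?_ measurable_snd)
        exact measurable_pi_lambda _ fun p => (measurable_pi_apply _).comp measurable_fst
      convert h1 using 1
      funext q
      simp only [Function.uncurry]
      split
      · simp_all
      · rfl
    · obtain ⟨x, hx⟩ := Option.ne_none_iff_exists'.mp h
      convert (measurable_const (a := x)) using 1
      funext q
      simp only [Function.uncurry]
      split <;> simp_all

/-- `do(T = t)`. -/
def doTreatment (M : SCM 𝒴 𝒳 𝒰) (t : Bool) : SCM 𝒴 𝒳 𝒰 :=
  M.atomicDo fun v => match v with
    | .treatment => some t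
    | _ => none

/-- The outcome's structural equation, with the parents of the outcome set to the values assigned to
them by `x`, as a function of the outcome's noise. -/
def outcomeFn (M : SCM 𝒴 𝒳 𝒰) (x : ∀ v, Val 𝒴 𝒳 𝒰 v) (u : M.Noise .outcome) : ℝ :=
  Subtype.val (p := (· ∈ 𝒴)) (M.mech .outcome (fun p => x p.1) u)

/-- `E[Y | Pa(Y) = a]`, where `a` consists of the values that `x` assigns to the parents of `Y`:
the mean of the outcome's structural equation over its noise when the parents are set to `a`.
Since the noise of `Y` is independent of the parents of `Y`, this is the regular version of the
conditional expectation; it is determined at every `a`, also at those of probability zero. -/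
noncomputable def outcomeMean (M : SCM 𝒴 𝒳 𝒰) (x : ∀ v, Val 𝒴 𝒳 𝒰 v) : ℝ :=
  ∫ u, M.outcomeFn x u ∂(M.noiseLaw .outcome)

/-- `E[Y | Pa(Y) = a]` exists for every `a`. -/
def HasOutcomeMean (M : SCM 𝒴 𝒳 𝒰) : Prop :=
  ∀ x : (∀ v, Val 𝒴 𝒳 𝒰 v), Integrable (M.outcomeFn x) (M.noiseLaw .outcome)

/-- `V(Y | Pa(Y) = a)` is finite for every `a`. -/
def HasOutcomeVariance (M : SCM 𝒴 𝒳 𝒰) : Prop :=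
  ∀ x : (∀ v, Val 𝒴 𝒳 𝒰 v), MemLp (M.outcomeFn x) 2 (M.noiseLaw .outcome)

/-- `N` results from `M` by an intervention, atomic or stochastic. An intervention may replace the
structural equation and the noise of any set of variables; an intervened variable may lose
parents (it loses all of them if the intervention is atomic) but gains none. As any set of
variables may be the target, the only constraint is that no edge is added. -/
def IsIntervention (M N : SCM 𝒴 𝒳 𝒰) : Prop :=
  ∀ p v, N.edge p v → M.edge p v

/-- `N` is a valid environment with respect to `M`: it is created by an intervention that preserves
`E[Y | Pa(Y) = a]` for every value `a` of the parents (in `M`) of the outcome, and under which the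
conditional variance of the outcome given these parents is finite. -/
structure IsValidEnv (M N : SCM 𝒴 𝒳 𝒰) : Prop where
  isIntervention : IsIntervention M N
  hasOutcomeMean : M.HasOutcomeMean
  outcomeMean_eq : ∀ x : (∀ v, Val 𝒴 𝒳 𝒰 v), N.outcomeMean x = M.outcomeMean x
  hasOutcomeVariance : N.HasOutcomeVariance

/-- Every parent of the outcome is the treatment or an observed covariate. -/
def ObservesParents (M : SCM 𝒴 𝒳 𝒰) : Prop :=
  ∀ j : κ, ¬ M.edge (.latent j) .outcome

/-- No observed covariate lies on a directed path from the treatment to the outcome. -/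
def NoMediators (M : SCM 𝒴 𝒳 𝒰) : Prop :=
  ∀ i : ι, ¬ (Relation.TransGen M.edge .treatment (.covariate i) ∧
    Relation.TransGen M.edge (.covariate i) .outcome)

end Basic

section Solution

variable {ι κ : Type*} [Fintype ι] [Fintype κ] {𝒴 : Set ℝ} {𝒳 : ι → Type} {𝒰 : κ → Type}
  [∀ i, MeasurableSpace (𝒳 i)] [∀ j, MeasurableSpace (𝒰 j)]

theorem wellFounded_edge (M : SCM 𝒴 𝒳 𝒰) : WellFounded M.edge := by
  have : Std.Irrefl (Relation.TransGen M.edge) := ⟨M.acyclic⟩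
  exact Subrelation.wf (fun h => Relation.TransGen.single h)
    (Finite.wellFounded_of_trans_of_irrefl (Relation.TransGen M.edge))

/-- The joint law of the noise variables. -/
noncomputable def noise (M : SCM 𝒴 𝒳 𝒰) : Measure (∀ v, M.Noise v) :=
  Measure.pi M.noiseLaw

/-- The solution of the structural equations, as a function of the noise. -/
noncomputable def solution (M : SCM 𝒴 𝒳 𝒰) (u : ∀ v, M.Noise v) : ∀ v, Val 𝒴 𝒳 𝒰 v :=
  M.wellFounded_edge.fix fun v rec => M.mech v (fun p => rec p.1 p.2) (u v)

theorem solution_eq (M : SCM 𝒴 𝒳 𝒰) (u : ∀ v, M.Noise v) (v : Node ι κ) :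
    M.solution u v = M.mech v (fun p => M.solution u p.1) (u v) :=
  M.wellFounded_edge.fix_eq _ v

/-- The treatment. -/
noncomputable def T (M : SCM 𝒴 𝒳 𝒰) (u : ∀ v, M.Noise v) : Bool :=
  M.solution u .treatment

/-- The observed covariates. -/
noncomputable def X (M : SCM 𝒴 𝒳 𝒰) (u : ∀ v, M.Noise v) (i : ι) : 𝒳 i :=
  M.solution u (.covariate i)

/-- The outcome. -/
noncomputable def Y (M : SCM 𝒴 𝒳 𝒰) (u : ∀ v, M.Noise v) : 𝒴 :=
  M.solution u .outcome

/-- The outcome under `do(T = t)` of the unit with noise `u`. -/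
noncomputable def Ydo (M : SCM 𝒴 𝒳 𝒰) (t : Bool) (u : ∀ v, M.Noise v) : ℝ :=
  Subtype.val (Y (M.doTreatment t) u)

/-- The conditional law of the noise given `T = 1`. -/
noncomputable def treated (M : SCM 𝒴 𝒳 𝒰) : Measure (∀ v, M.Noise v) :=
  M.noise[|{u | M.T u = true}]

/-- The average treatment effect on the treated,
`E[Y | do(T = 1), T = 1] - E[Y | do(T = 0), T = 1]`. -/
noncomputable def att (M : SCM 𝒴 𝒳 𝒰) : ℝ :=
  (∫ u, M.Ydo true u ∂M.treated) - ∫ u, M.Ydo false u ∂M.treated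

/-- The risk of a predictor `f` of `Y` from `(T, X)` under the loss `L`. -/
noncomputable def risk (M : SCM 𝒴 𝒳 𝒰) (L : ℝ → 𝒴 → ℝ≥0∞) (f : Bool × (∀ i, 𝒳 i) → ℝ) : ℝ≥0∞ :=
  ∫⁻ u, L (f (M.T u, M.X u)) (M.Y u) ∂M.noise

/-- On top of the representation `Φ`, the function `w` is simultaneously optimal in all valid
environments with respect to `M`; the elicited invariant predictor is `w ∘ Φ`. -/
def ElicitsInvariant {H : Type*} [MeasurableSpace H] (M : SCM 𝒴 𝒳 𝒰) (L : ℝ → 𝒴 → ℝ≥0∞)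
    (Φ : Bool × (∀ i, 𝒳 i) → H) (w : H → ℝ) : Prop :=
  Measurable w ∧ ∀ N : SCM 𝒴 𝒳 𝒰, M.IsValidEnv N →
    ∀ w' : H → ℝ, Measurable w' → N.risk L (w ∘ Φ) ≤ N.risk L (w' ∘ Φ)

end Solution

end SCM

/-- The minimizer of the risk associated with the loss `L` (first argument the prediction, second
argument the outcome) is a conditional expectation: for every joint law of a feature `h` in `H` and
a square-integrable outcome `y` in `𝒴`, every measurable `w` that minimizes the risk
`E[L (w h) y]` satisfies `w h = E[y | h]` almost surely. -/
def IsCondExpLoss (H : Type*) [MeasurableSpace H] {𝒴 : Set ℝ} (L : ℝ → 𝒴 → ℝ≥0∞) : Prop :=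
  ∀ μ : Measure (H × 𝒴), IsProbabilityMeasure μ → MemLp (fun z => (z.2 : ℝ)) 2 μ →
    ∀ w : H → ℝ, Measurable w →
      (∀ w' : H → ℝ, Measurable w' →
        ∫⁻ z, L (w z.1) z.2 ∂μ ≤ ∫⁻ z, L (w' z.1) z.2 ∂μ) →
      (fun z => w z.1) =ᵐ[μ]
        μ[fun z => (z.2 : ℝ) | MeasurableSpace.comap Prod.fst inferInstance]

/-! The key is that optimality in all valid environments determines `w ∘ Φ` at every point, not
merely almost everywhere. Fixing every variable but the outcome to the values in `x` gives another
valid environment (`IsValidEnv.atomicDo`). There the representation is constant, so the conditional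
expectation that a minimizer must equal has as its mean the mean of the outcome at `x`. Hence `w ∘
Φ` is E[Y | Pa(Y)] everywhere (`eq_outcomeMean`), so evaluating it at the untreated value on treated
units needs no overlap.

It remains to adjust. Without mediators, do(T = t) changes no parent of Y other than T
(`Ydo_eq_outcomeFn`). If T is a parent of Y, acyclicity makes the noise of Y independent of T and
the other parents, and Fubini averages it out among the treated (`integral_Ydo_treated`). If T is
not a parent of Y, it may descend from Y, so conditioning on T = 1 can be informative about that
noise; but then both contrasts vanish pointwise. -/

namespace SCM

section Assignments

variable {ι κ : Type*} {𝒴 : Set ℝ} {𝒳 : ι → Type} {𝒰 : κ → Type}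

/-- Replace the value of the treatment. -/
def setTreatment (x : ∀ v, Val 𝒴 𝒳 𝒰 v) (t : Bool) : ∀ v, Val 𝒴 𝒳 𝒰 v
  | .treatment => t
  | v => x v

theorem setTreatment_of_ne (x : ∀ v, Val 𝒴 𝒳 𝒰 v) (t : Bool) {v : Node ι κ}
    (hv : v ≠ .treatment) : setTreatment x t v = x v := by
  cases v with
  | treatment => exact absurd rfl hv
  | _ => rfl

end Assignments

/-! ### Structural equations under atomic interventions -/

section Interventions

variable {ι κ : Type*} {𝒴 : Set ℝ} {𝒳 : ι → Type} {𝒰 : κ → Type}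
  [∀ i, MeasurableSpace (𝒳 i)] [∀ j, MeasurableSpace (𝒰 j)]

theorem outcomeFn_congr (M : SCM 𝒴 𝒳 𝒰) {x y : ∀ v, Val 𝒴 𝒳 𝒰 v}
    (h : ∀ p, M.edge p .outcome → x p = y p) : M.outcomeFn x = M.outcomeFn y := by
  funext u
  have : (fun p : {p // M.edge p .outcome} => x p.1) =
      fun p : {p // M.edge p .outcome} => y p.1 :=
    funext fun p => h p.1 p.2
  simp only [outcomeFn, this]

theorem outcomeMean_congr (M : SCM 𝒴 𝒳 𝒰) {x y : ∀ v, Val 𝒴 𝒳 𝒰 v}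
    (h : ∀ p, M.edge p .outcome → x p = y p) : M.outcomeMean x = M.outcomeMean y := by
  rw [outcomeMean, outcomeMean, M.outcomeFn_congr h]

theorem atomicDo_mech_of_none (M : SCM 𝒴 𝒳 𝒰) (c : ∀ v, Option (Val 𝒴 𝒳 𝒰 v))
    {v : Node ι κ} (h : c v = none) (x : ∀ v, Val 𝒴 𝒳 𝒰 v) (u : M.Noise v) :
    (M.atomicDo c).mech v (fun p => x p.1) u = M.mech v (fun p => x p.1) u := by
  simp only [atomicDo]
  split
  · simp_all
  · rfl

theorem atomicDo_mech_of_some (M : SCM 𝒴 𝒳 𝒰) (c : ∀ v, Option (Val 𝒴 𝒳 𝒰 v))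
    {v : Node ι κ} {a : Val 𝒴 𝒳 𝒰 v} (h : c v = some a) (x : ∀ v, Val 𝒴 𝒳 𝒰 v)
    (u : M.Noise v) : (M.atomicDo c).mech v (fun p => x p.1) u = a := by
  simp only [atomicDo]
  split <;> simp_all

theorem atomicDo_outcomeFn (M : SCM 𝒴 𝒳 𝒰) (c : ∀ v, Option (Val 𝒴 𝒳 𝒰 v))
    (h : c .outcome = none) (x : ∀ v, Val 𝒴 𝒳 𝒰 v) :
    (M.atomicDo c).outcomeFn x = M.outcomeFn x := by
  funext u
  exact congrArg (Subtype.val (p := (· ∈ 𝒴))) (M.atomicDo_mech_of_none c h x u)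

/-- Atomic interventions on variables other than the outcome preserve validity. -/
theorem IsValidEnv.atomicDo {M E : SCM 𝒴 𝒳 𝒰} (hE : M.IsValidEnv E)
    (c : ∀ v, Option (Val 𝒴 𝒳 𝒰 v)) (h : c .outcome = none) :
    M.IsValidEnv (E.atomicDo c) where
  isIntervention p v hp := hE.isIntervention p v hp.2
  hasOutcomeMean := hE.hasOutcomeMean
  outcomeMean_eq x := by
    rw [← hE.outcomeMean_eq x, outcomeMean, atomicDo_outcomeFn E c h]
    rfl
  hasOutcomeVariance x := by
    rw [atomicDo_outcomeFn E c h]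
    exact hE.hasOutcomeVariance x

theorem measurable_outcomeFn (M : SCM 𝒴 𝒳 𝒰) (x : ∀ v, Val 𝒴 𝒳 𝒰 v) :
    Measurable (M.outcomeFn x) :=
  measurable_subtype_coe.comp
    ((M.measurable_mech .outcome).comp (measurable_const.prodMk measurable_id))

/-- The intervention that sets every variable except the outcome to its value in `x`. -/
def fixCovariates (M : SCM 𝒴 𝒳 𝒰) (x : ∀ v, Val 𝒴 𝒳 𝒰 v) : SCM 𝒴 𝒳 𝒰 :=
  M.atomicDo fun v => match v with
    | .outcome => none
    | v => some (x v)

end Interventions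

/-! ### How noise and interventions propagate through the graph -/

section Solutions

variable {ι κ : Type*} [Fintype ι] [Fintype κ] {𝒴 : Set ℝ} {𝒳 : ι → Type} {𝒰 : κ → Type}
  [∀ i, MeasurableSpace (𝒳 i)] [∀ j, MeasurableSpace (𝒰 j)]

instance (M : SCM 𝒴 𝒳 𝒰) : IsProbabilityMeasure M.noise := by
  unfold noise
  infer_instance

theorem measurable_solution (M : SCM 𝒴 𝒳 𝒰) (v : Node ι κ) :
    Measurable fun u => M.solution u v := by
  induction v using M.wellFounded_edge.induction with
  | _ v ih =>
    simp_rw [M.solution_eq _ v]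
    exact (M.measurable_mech v).comp
      ((measurable_pi_lambda _ fun p => ih p.1 p.2).prodMk (measurable_pi_apply v))

theorem measurable_T (M : SCM 𝒴 𝒳 𝒰) : Measurable M.T := M.measurable_solution .treatment

/-- The noise of `v` influences only `v` and its descendants. -/
theorem solution_update_noise [DecidableEq (Node ι κ)] (M : SCM 𝒴 𝒳 𝒰) (u : ∀ v, M.Noise v)
    (v : Node ι κ) (y : M.Noise v) (q : Node ι κ) (hq : ¬ Relation.ReflTransGen M.edge v q) :
    M.solution (Function.update u v y) q = M.solution u q := by
  induction q using M.wellFounded_edge.induction with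
  | _ q ih =>
    have hne : q ≠ v := by
      rintro rfl
      exact hq .refl
    rw [M.solution_eq, M.solution_eq u, Function.update_of_ne hne]
    congr 1
    funext p
    exact ih p.1 p.2 fun h => hq (h.tail p.2)

/-- An intervention on the treatment influences only the treatment and its descendants. -/
theorem solution_doTreatment (M : SCM 𝒴 𝒳 𝒰) (t : Bool) (u : ∀ v, M.Noise v) (q : Node ι κ)
    (hq : ¬ Relation.ReflTransGen M.edge .treatment q) :
    (M.doTreatment t).solution u q = M.solution u q := by
  induction q using M.wellFounded_edge.induction with
  | _ q ih =>
    refine ((M.doTreatment t).solution_eq u q).trans ?_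
    refine (M.atomicDo_mech_of_none _ ?_ _ _).trans ?_
    · cases q with
      | treatment => exact absurd .refl hq
      | _ => rfl
    · rw [M.solution_eq]
      refine congrArg (fun a => M.mech q a (u q)) (funext fun p => ?_)
      exact ih p.1 p.2 fun h => hq (h.tail p.2)

theorem solution_doTreatment_treatment (M : SCM 𝒴 𝒳 𝒰) (t : Bool) (u : ∀ v, M.Noise v) :
    (M.doTreatment t).solution u .treatment = t :=
  ((M.doTreatment t).solution_eq u .treatment).trans (M.atomicDo_mech_of_some _ rfl _ _)

/-- Without mediators, the outcome under `do(T = t)` is obtained by changing the value of the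
treatment only. -/
theorem Ydo_eq_outcomeFn (M : SCM 𝒴 𝒳 𝒰) (hobs : M.ObservesParents)
    (hmed : M.NoMediators) (t : Bool) (u : ∀ v, M.Noise v) :
    M.Ydo t u = M.outcomeFn (setTreatment (M.solution u) t) (u .outcome) := by
  have h1 : M.Ydo t u = M.outcomeFn ((M.doTreatment t).solution u) (u .outcome) := by
    refine congrArg (Subtype.val (p := (· ∈ 𝒴))) ?_
    refine ((M.doTreatment t).solution_eq u .outcome).trans ?_
    exact M.atomicDo_mech_of_none _ rfl _ _
  rw [h1, M.outcomeFn_congr]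
  intro p hp
  cases p with
  | treatment => exact M.solution_doTreatment_treatment t u
  | outcome => exact absurd (.single hp) (M.acyclic _)
  | latent j => exact absurd hp (hobs j)
  | covariate i =>
    -- A covariate that is a parent of Y and descends from T would be a mediator.
    refine M.solution_doTreatment t u _ fun h => ?_
    rcases Relation.reflTransGen_iff_eq_or_transGen.mp h with h | h
    · cases h
    · exact hmed i ⟨h, .single hp⟩

theorem fixCovariates_solution (M : SCM 𝒴 𝒳 𝒰) (x : ∀ v, Val 𝒴 𝒳 𝒰 v) (u : ∀ v, M.Noise v)
    {v : Node ι κ} (hv : v ≠ .outcome) : (M.fixCovariates x).solution u v = x v := by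
  refine ((M.fixCovariates x).solution_eq u v).trans (M.atomicDo_mech_of_some _ ?_ _ _)
  cases v with
  | outcome => exact absurd rfl hv
  | _ => rfl

theorem fixCovariates_Y (M : SCM 𝒴 𝒳 𝒰) (x : ∀ v, Val 𝒴 𝒳 𝒰 v) (u : ∀ v, M.Noise v) :
    ((M.fixCovariates x).Y u : ℝ) = M.outcomeFn x (u .outcome) := by
  have h1 : ((M.fixCovariates x).Y u : ℝ) =
      M.outcomeFn ((M.fixCovariates x).solution u) (u .outcome) := by
    refine congrArg (Subtype.val (p := (· ∈ 𝒴))) ?_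
    refine ((M.fixCovariates x).solution_eq u .outcome).trans ?_
    exact M.atomicDo_mech_of_none _ rfl _ _
  rw [h1, M.outcomeFn_congr]
  intro p hp
  refine M.fixCovariates_solution x u ?_
  rintro rfl
  exact M.acyclic _ (.single hp)

/-! ### Identification of the invariant predictor -/

/-- The invariant predictor agrees everywhere with the mean of the outcome given its parents. -/
theorem ElicitsInvariant.eq_outcomeMean {H : Type*} [MeasurableSpace H] {M E : SCM 𝒴 𝒳 𝒰}
    {L : ℝ → 𝒴 → ℝ≥0∞} (hLm : Measurable (Function.uncurry L)) (hL : IsCondExpLoss H L)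
    {Φ : Bool × (∀ i, 𝒳 i) → H} {w : H → ℝ} (hw : M.ElicitsInvariant L Φ w)
    (hE : M.IsValidEnv E) (x : ∀ v, Val 𝒴 𝒳 𝒰 v) :
    w (Φ (x .treatment, fun i => x (.covariate i))) = E.outcomeMean x := by
  set h₀ := Φ (x .treatment, fun i => x (.covariate i))
  set N := E.fixCovariates x
  have hN : M.IsValidEnv N := hE.atomicDo _ rfl
  have hYm : Measurable N.Y := N.measurable_solution .outcome
  have hfm : Measurable fun u => (h₀, N.Y u) := measurable_const.prodMk hYm
  have heval : MeasurePreserving (fun u : ∀ v, E.Noise v => u .outcome) E.noise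
      (E.noiseLaw .outcome) := measurePreserving_eval E.noiseLaw .outcome
  have hY : (fun u => (N.Y u : ℝ)) = E.outcomeFn x ∘ fun u => u .outcome :=
    funext fun u => E.fixCovariates_Y x u
  have hrisk (w' : H → ℝ) (hw' : Measurable w') :
      ∫⁻ z, L (w' z.1) z.2 ∂(N.noise.map fun u => (h₀, N.Y u)) = N.risk L (w' ∘ Φ) := by
    have hm : Measurable fun z : H × 𝒴 => L (w' z.1) z.2 :=
      hLm.comp ((hw'.comp measurable_fst).prodMk measurable_snd)
    rw [lintegral_map hm hfm, risk]
    refine lintegral_congr fun u => ?_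
    have hT : N.T u = x .treatment := E.fixCovariates_solution x u (by simp)
    have hX : N.X u = fun i => x (.covariate i) :=
      funext fun i => E.fixCovariates_solution x u (by simp)
    simp only [Function.comp_apply, hT, hX]
    rfl
  have hym : Measurable fun z : H × 𝒴 => (z.2 : ℝ) := measurable_subtype_coe.comp measurable_snd
  have hwm : Measurable fun z : H × 𝒴 => w z.1 := hw.1.comp measurable_fst
  have hsq : MemLp (fun z : H × 𝒴 => (z.2 : ℝ)) 2 (N.noise.map fun u => (h₀, N.Y u)) := by
    rw [memLp_map_measure_iff hym.aestronglyMeasurable hfm.aemeasurable]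
    change MemLp (fun u => (N.Y u : ℝ)) 2 N.noise
    rw [hY]
    exact (hE.hasOutcomeVariance x).comp_measurePreserving heval
  have hprob : IsProbabilityMeasure (N.noise.map fun u => (h₀, N.Y u)) :=
    Measure.isProbabilityMeasure_map hfm.aemeasurable
  have hce := hL _ hprob hsq w hw.1 fun w' hw' => by
    rw [hrisk w hw.1, hrisk w' hw']
    exact hw.2 N hN w' hw'
  -- Integrating suffices: the left side is the constant `w h₀`, and the right side has the mean of
  -- Y whatever the conditioning σ-algebra.
  have hmean := integral_congr_ae hce
  rw [integral_condExp measurable_fst.comap_le,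
    integral_map hfm.aemeasurable hwm.aestronglyMeasurable,
    integral_map hfm.aemeasurable hym.aestronglyMeasurable] at hmean
  simp only [integral_const, probReal_univ, one_smul] at hmean
  have hpush : ∫ y, E.outcomeFn x y ∂(E.noise.map fun u => u .outcome) =
      ∫ u, E.outcomeFn x (u .outcome) ∂E.noise :=
    integral_map heval.measurable.aemeasurable (E.measurable_outcomeFn x).aestronglyMeasurable
  rw [heval.map_eq] at hpush
  rw [hmean, hY]
  exact hpush.symm

/-! ### Resampling the outcome noise and adjustment -/

/-- Resampling the noise of a single variable preserves the joint law of the noise. -/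
theorem measurePreserving_update_noise [DecidableEq (Node ι κ)] (M : SCM 𝒴 𝒳 𝒰)
    (v : Node ι κ) :
    MeasurePreserving (fun z : (∀ v, M.Noise v) × M.Noise v => Function.update z.1 v z.2)
      (M.noise.prod (M.noiseLaw v)) M.noise := by
  have hm : Measurable fun z : (∀ v, M.Noise v) × M.Noise v => Function.update z.1 v z.2 := by
    refine measurable_pi_lambda _ fun q => ?_
    by_cases hq : q = v
    · subst hq
      simpa using measurable_snd
    · simpa [Function.update_of_ne hq] using measurable_fst.eval
  refine ⟨hm, ?_⟩
  symm
  refine Measure.pi_eq fun s hs => ?_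
  rw [Measure.map_apply hm (MeasurableSet.univ_pi hs)]
  -- The old coordinate `v` is discarded, hence unconstrained; its factor of mass 1 is replaced by
  -- that of the fresh copy.
  have hpre : (fun z : (∀ v, M.Noise v) × M.Noise v => Function.update z.1 v z.2) ⁻¹'
      Set.univ.pi s = (Set.univ.pi (Function.update s v Set.univ)) ×ˢ s v := by
    ext z
    simp only [Set.mem_preimage, Set.mem_univ_pi, Set.mem_prod]
    constructor
    · refine fun h => ⟨fun q => ?_, by simpa using h v⟩
      by_cases hq : q = v
      · subst hq
        simp
      · simpa [Function.update_of_ne hq] using h q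
    · rintro ⟨h1, h2⟩ q
      by_cases hq : q = v
      · subst hq
        simpa using h2
      · simpa [Function.update_of_ne hq] using h1 q
  rw [hpre, Measure.prod_prod, noise, Measure.pi_pi,
    ← Finset.prod_erase_mul _ _ (Finset.mem_univ v),
    ← Finset.prod_erase_mul (Finset.univ) (fun q => M.noiseLaw q (s q)) (Finset.mem_univ v)]
  simp only [Function.update_self, measure_univ, mul_one]
  congr 1
  refine Finset.prod_congr rfl fun q hq => ?_
  rw [Function.update_of_ne (Finset.ne_of_mem_erase hq)]

/-- Adjustment formula: if the treatment is a parent of the outcome and there are no mediators, the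
mean of the outcome under `do(T = t)` among the treated is the mean of
`E[Y | Pa(Y)]` with the treatment set to `t`. -/
theorem integral_Ydo_treated [DecidableEq (Node ι κ)] (M : SCM 𝒴 𝒳 𝒰)
    (hobs : M.ObservesParents) (hmed : M.NoMediators) (hT : M.edge .treatment .outcome)
    (hpos : M.noise {u | M.T u = true} ≠ 0) (t : Bool) (hint : Integrable (M.Ydo t) M.treated) :
    Integrable (fun u => M.outcomeMean (setTreatment (M.solution u) t)) M.treated ∧
      ∫ u, M.Ydo t u ∂M.treated =
        ∫ u, M.outcomeMean (setTreatment (M.solution u) t) ∂M.treated := by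
  set S := {u | M.T u = true}
  have hS : MeasurableSet S := M.measurable_T (measurableSet_singleton true)
  -- A parent of Y that descended from Y would close a cycle.
  have hparent (p : Node ι κ) (hp : M.edge p .outcome) (u : ∀ v, M.Noise v)
      (y : M.Noise .outcome) :
      M.solution (Function.update u .outcome y) p = M.solution u p :=
    M.solution_update_noise u _ y p fun h => M.acyclic _ (Relation.TransGen.tail' h hp)
  have hfun (u : ∀ v, M.Noise v) (y : M.Noise .outcome) :
      S.indicator (M.Ydo t) (Function.update u .outcome y) = S.indicator
        (fun u => M.outcomeFn (setTreatment (M.solution u) t) y) u := by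
    -- This is where T being a parent of Y matters: resampling the noise of Y does not change who is
    -- treated.
    have hmem : Function.update u .outcome y ∈ S ↔ u ∈ S := by
      simp only [S, Set.mem_ofPred_eq, T, hparent _ hT]
    by_cases hu : u ∈ S
    · rw [Set.indicator_of_mem hu, Set.indicator_of_mem (hmem.mpr hu),
        M.Ydo_eq_outcomeFn hobs hmed, Function.update_self, M.outcomeFn_congr]
      intro p hp
      by_cases hpt : p = .treatment
      · subst hpt
        rfl
      · rw [setTreatment_of_ne _ _ hpt, setTreatment_of_ne _ _ hpt, hparent p hp]
    · rw [Set.indicator_of_notMem hu, Set.indicator_of_notMem (mt hmem.mp hu)]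
  have hind (u : ∀ v, M.Noise v) :
      ∫ y, S.indicator (M.Ydo t) (Function.update u .outcome y) ∂M.noiseLaw .outcome =
        S.indicator (fun u => M.outcomeMean (setTreatment (M.solution u) t)) u := by
    simp_rw [hfun]
    by_cases hu : u ∈ S
    · simp only [Set.indicator_of_mem hu]
      rfl
    · simp [Set.indicator_of_notMem hu]
  -- Conditioning on S is restriction up to a finite nonzero factor, so everything reduces to
  -- indicators under the full noise law.
  have hc0 : (M.noise S)⁻¹ ≠ 0 := ENNReal.inv_ne_zero.mpr (measure_ne_top _ _)
  have hct : (M.noise S)⁻¹ ≠ ⊤ := ENNReal.inv_ne_top.mpr hpos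
  have htr : M.treated = (M.noise S)⁻¹ • M.noise.restrict S := rfl
  rw [htr, integrable_smul_measure hc0 hct] at hint
  have hg : Integrable (S.indicator (M.Ydo t)) M.noise := (integrable_indicator_iff hS).mpr hint
  have hmp := M.measurePreserving_update_noise .outcome
  have hgp := hmp.integrable_comp_of_integrable hg
  -- Integrating out the fresh outcome noise gives integrability of the mean as well.
  have hmarg := hgp.integral_prod_left
  simp only [Function.comp_apply, hind] at hmarg
  rw [htr, integrable_smul_measure hc0 hct, integral_smul_measure, integral_smul_measure,
    ← integral_indicator hS, ← integral_indicator hS]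
  refine ⟨(integrable_indicator_iff hS).mp hmarg, congrArg _ ?_⟩
  calc ∫ u, S.indicator (M.Ydo t) u ∂M.noise
      = ∫ z, (S.indicator (M.Ydo t) ∘ fun z => Function.update z.1 .outcome z.2) z
          ∂(M.noise.prod (M.noiseLaw .outcome)) := by
        have h := integral_map hmp.measurable.aemeasurable
          (hmp.map_eq.symm ▸ hg.aestronglyMeasurable)
        rwa [hmp.map_eq] at h
    _ = _ := by
        rw [integral_prod _ hgp]
        simp only [Function.comp_apply, hind]

end Solutions

end SCM

/-! ### The effect on the treated -/

theorem mainTheorem1 {ι κ H : Type*} [Fintype ι] [Fintype κ] [MeasurableSpace H]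
    {𝒴 : Set ℝ} {𝒳 : ι → Type} {𝒰 : κ → Type}
    [∀ i, MeasurableSpace (𝒳 i)] [∀ j, MeasurableSpace (𝒰 j)]
    (M : SCM 𝒴 𝒳 𝒰) (hM : M.ObservesParents)
    (L : ℝ → 𝒴 → ℝ≥0∞) (hLm : Measurable (Function.uncurry L)) (hL : IsCondExpLoss H L)
    (Φ : Bool × (∀ i, 𝒳 i) → H) (hΦ : Measurable Φ)
    (w : H → ℝ) (hw : M.ElicitsInvariant L Φ w)
    (Q : Bool → (∀ i, 𝒳 i) → ℝ) (hQ : ∀ t x, Q t x = w (Φ (t, x)))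
    (E : SCM 𝒴 𝒳 𝒰) (hE : M.IsValidEnv E) (hmed : E.NoMediators)
    (hpos : E.noise {u | E.T u = true} ≠ 0)
    (hint : ∀ t, Integrable (E.Ydo t) E.treated) :
    Integrable (fun u => Q true (E.X u) - Q false (E.X u)) E.treated ∧
      E.att = ∫ u, (Q true (E.X u) - Q false (E.X u)) ∂E.treated := by
  classical
  have hobs : E.ObservesParents := fun j h => hM j (hE.isIntervention _ _ h)
  have hQm (t : Bool) (u : ∀ v, E.Noise v) :
      Q t (E.X u) = E.outcomeMean (SCM.setTreatment (E.solution u) t) := by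
    rw [hQ, ← hw.eq_outcomeMean hLm hL hE]
    rfl
  simp only [SCM.att, hQm]
  by_cases hT : E.edge .treatment .outcome
  · obtain ⟨i1, e1⟩ := E.integral_Ydo_treated hobs hmed hT hpos true (hint true)
    obtain ⟨i0, e0⟩ := E.integral_Ydo_treated hobs hmed hT hpos false (hint false)
    exact ⟨i1.sub i0, by rw [e1, e0, integral_sub i1 i0]⟩
  -- Neither the structural equation of Y nor its mean depends on the treatment value here, so both
  -- sides are zero.
  · have hpar (u : ∀ v, E.Noise v) (p : Node ι κ) (hp : E.edge p .outcome) :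
        SCM.setTreatment (E.solution u) true p = SCM.setTreatment (E.solution u) false p := by
      have hne : p ≠ .treatment := by
        rintro rfl
        exact hT hp
      rw [SCM.setTreatment_of_ne _ _ hne, SCM.setTreatment_of_ne _ _ hne]
    have hmean (u : ∀ v, E.Noise v) := E.outcomeMean_congr (hpar u)
    have hYdo (u : ∀ v, E.Noise v) : E.Ydo true u = E.Ydo false u := by
      rw [E.Ydo_eq_outcomeFn hobs hmed, E.Ydo_eq_outcomeFn hobs hmed, E.outcomeFn_congr (hpar u)]
    simp [hmean, hYdo]
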